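/- For $n,k\ge 0$ let $\mathcal F_{n,k}$ be the set of fillings $F$ of the $k\times n$ array ($k$ rows, $n$ columns) with the integers $1,\dots,kn$, each used once, such that every column increases from bottom to top, and let $St_{n^k}\subseteq\mathcal F_{n,k}$ be the set of standard tableaux of shape $n^k$, i.e. those fillings whose rows also increase from left to right. For a set $\Upsilon\subseteq\mathcal F_{2,k}$ and $F\in\mathcal F_{n,k}$, an $\Upsilon$-match of $F$ at position $i$ $(1\le i\le n-1)$ means that columns $i,i+1$ of $F$, after replacing their $r$-th smallest entry by $r$ for $r=1,\dots,2k$, form an element of $\Upsilon$. Let $\Upsilon\text{-mch}(F)$ be the number of $\Upsilon$-matches of $F$, let $full_n^\Upsilon$ be the number of $F\in\mathcal F_{n,k}$ with $\Upsilon\text{-mch}(F)=n-1$, let $A_{n,k}^\Upsilon$ be the number of $F\in\mathcal F_{n,k}$ with no $\Upsilon$-match, and put $$D^\Upsilon(x,t)=1+\sum_{n\ge1}\frac{t^n}{(kn)!}\sum_{F\in\mathcal F_{n,k}}x^{\Upsilon\text{-mch}(F)},\qquad A^\Upsilon(t)=D^\Upsilon(0,t)=1+\sum_{n\ge1}\frac{A^\Upsilon_{n,k}\,t^n}{(kn)!},$$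 as formal power series in $t$ over $\mathbb Q[x]$ and over $\mathbb Q$, respectively. Write $(m)\downarrow_n=m(m-1)\cdots(m-n+1)$. **Corollary.** For every $n\ge1$, $$full_n^{St_{2^k}}=|St_{n^k}|=\frac{(kn)!}{\prod_{i=1}^{k}(n+i-1)\downarrow_n}.$$ Moreover, as formal power series in $t$ over $\mathbb Q(x)$ and over $\mathbb Q$, respectively, $$D^{St_{2^k}}(x,t)=\frac{1-x}{1-x+(x-1)\frac{t}{k!}+\sum_{n\ge2}\frac{((x-1)t)^n}{\prod_{i=1}^k(n+i-1)\downarrow_n}}$$ and $$A^{St_{2^k}}(t)=\frac{1}{1-\frac{t}{k!}+\sum_{n\ge2}\frac{(-t)^n}{\prod_{i=1}^k(n+i-1)\downarrow_n}}.$$ -/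

import Mathlib

/-- `Filling n k` is the set `F_{n,k}` of bijective fillings of the `k × n` array (`k` rows,
`n` columns) whose columns increase from bottom to top.  The cell `(i, j)` lies in the `i`-th row
from the bottom and the `j`-th column from the left, both counted from `0`; the integers
`1, …, kn` are represented by the elements `0, …, kn - 1` of `Fin (k * n)`. -/
abbrev Filling (n k : ℕ) : Type :=
  {F : Fin k × Fin n ≃ Fin (k * n) // ∀ (j : Fin n) (a b : Fin k), a < b → F (a, j) < F (b, j)}

namespace Filling

/-- The set `St_{n^k}` of standard tableaux of shape `n^k`: the elements of `F_{n,k}` whose rows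
increase from left to right. -/
def standardTableaux (n k : ℕ) : Finset (Filling n k) :=
  Finset.univ.filter fun F => ∀ (i : Fin k) (a b : Fin n), a < b → F.1 (i, a) < F.1 (i, b)

/-- The number of entries of the array `G` that are smaller than the entry in cell `c`. -/
def rank {m k N : ℕ} (G : Fin k × Fin m → Fin N) (c : Fin k × Fin m) : ℕ :=
  (Finset.univ.filter fun d => G d < G c).card

theorem rank_lt {m k N : ℕ} (G : Fin k × Fin m → Fin N) (c : Fin k × Fin m) :
    rank G c < k * m := by
  have h : (Finset.univ.filter fun d => G d < G c) ⊂ Finset.univ :=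
    Finset.filter_ssubset.2 ⟨c, Finset.mem_univ c, lt_irrefl _⟩
  simpa [rank] using Finset.card_lt_card h

theorem rank_lt_rank {m k N : ℕ} (G : Fin k × Fin m → Fin N) {c d : Fin k × Fin m}
    (h : G c < G d) : rank G c < rank G d := by
  apply Finset.card_lt_card
  rw [Finset.ssubset_iff_of_subset]
  · exact ⟨c, by simp [h], by simp⟩
  · intro e he
    simp only [Finset.mem_filter, Finset.mem_univ, true_and] at he ⊢
    exact he.trans h

theorem rank_bijective {m k N : ℕ} (G : Fin k × Fin m → Fin N) (hG : Function.Injective G) :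
    Function.Bijective fun c => (⟨rank G c, rank_lt G c⟩ : Fin (k * m)) := by
  rw [Fintype.bijective_iff_injective_and_card]
  refine ⟨fun c d h => ?_, by simp⟩
  have h' : rank G c = rank G d := congrArg Fin.val h
  rcases lt_trichotomy (G c) (G d) with hlt | heq | hgt
  · exact absurd h' (rank_lt_rank G hlt).ne
  · exact hG heq
  · exact absurd h' (rank_lt_rank G hgt).ne'

/-- The reduction `red(G)` of an array `G` with distinct entries and increasing columns: its
`i`-th smallest entry is replaced by the `i`-th smallest element of `Fin (k * m)`. -/
noncomputable def red {m k N : ℕ} (G : Fin k × Fin m → Fin N) (hG : Function.Injective G)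
    (hcol : ∀ (j : Fin m) (a b : Fin k), a < b → G (a, j) < G (b, j)) : Filling m k :=
  ⟨Equiv.ofBijective _ (rank_bijective G hG), fun j a b hab => rank_lt_rank G (hcol j a b hab)⟩

/-- The `j` consecutive columns of `F` that start with column `i` (counted from `0`). -/
def window {n k : ℕ} (F : Filling n k) (j i : ℕ) (h : i + j ≤ n) : Fin k × Fin j → Fin (k * n) :=
  fun c => F.1 (c.1, ⟨i + c.2, by omega⟩)

theorem window_injective {n k : ℕ} (F : Filling n k) (j i : ℕ) (h : i + j ≤ n) :
    Function.Injective (window F j i h) := by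
  rintro ⟨a, b⟩ ⟨c, d⟩ hcd
  have := F.1.injective hcd
  simp only [Prod.mk.injEq, Fin.mk.injEq] at this
  exact Prod.ext this.1 (Fin.ext (by simpa using this.2))

/-- `F` has a `Υ`-match starting at column `i` (counted from `0`):
the reduction of the `j` consecutive columns starting there belongs to `Υ ⊆ F_{j,k}`. -/
def HasMatchAt {n j k : ℕ} (Υ : Finset (Filling j k)) (F : Filling n k) (i : ℕ) : Prop :=
  ∃ h : i + j ≤ n,
    red (window F j i h) (window_injective F j i h) (fun _ a b hab => F.2 _ a b hab) ∈ Υ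

open Classical in
/-- `Υ-mch(F)`, the number of `Υ`-matches in `F`, for a set `Υ ⊆ F_{2,k}` of two-column
patterns. -/
noncomputable def mch {n k : ℕ} (Υ : Finset (Filling 2 k)) (F : Filling n k) : ℕ :=
  ((Finset.range n).filter fun i => HasMatchAt Υ F i).card

/-- `full_n^Υ`, for `n ≥ 1`: the number of `F ∈ F_{n,k}` with `Υ-mch(F) = n - 1`. -/
noncomputable def full {k : ℕ} (Υ : Finset (Filling 2 k)) (n : ℕ) : ℕ :=
  (Finset.univ.filter fun F : Filling n k => mch Υ F + 1 = n).card

/-- `A_{n,k}^Υ`, the number of `F ∈ F_{n,k}` that have no `Υ`-matches. -/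
noncomputable def avoidCount {k : ℕ} (Υ : Finset (Filling 2 k)) (n : ℕ) : ℕ :=
  (Finset.univ.filter fun F : Filling n k => mch Υ F = 0).card

/-- `D^Υ(x,t) = 1 + ∑_{n ≥ 1} t^n / (kn)! ∑_{F ∈ F_{n,k}} x^{Υ-mch(F)}`,
a formal power series in `t` over `ℚ[x]`. -/
noncomputable def genD {k : ℕ} (Υ : Finset (Filling 2 k)) : PowerSeries (Polynomial ℚ) :=
  1 + PowerSeries.mk fun n => if 1 ≤ n then
    Polynomial.C (1 / ((k * n).factorial : ℚ)) *
      ∑ F : Filling n k, (Polynomial.X : Polynomial ℚ) ^ mch Υ F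
  else 0

/-- `A^Υ(t) = 1 + ∑_{n ≥ 1} A_{n,k}^Υ t^n / (kn)!`, a formal power series in `t` over `ℚ`. -/
noncomputable def genA {k : ℕ} (Υ : Finset (Filling 2 k)) : PowerSeries ℚ :=
  1 + PowerSeries.mk fun n => if 1 ≤ n then
    (avoidCount Υ n : ℚ) / ((k * n).factorial : ℚ)
  else 0

/-- `A^Υ(t) = D^Υ(0,t)`. -/
theorem genA_eq_genD_zero {k : ℕ} (Υ : Finset (Filling 2 k)) :
    genA Υ = PowerSeries.map (Polynomial.evalRingHom (0 : ℚ)) (genD Υ) := by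
  rw [genA, genD, map_add, map_one]
  congr 1
  ext n
  rw [PowerSeries.coeff_map, PowerSeries.coeff_mk, PowerSeries.coeff_mk]
  split_ifs
  · simp only [avoidCount, Polynomial.coe_evalRingHom, Polynomial.eval_mul, Polynomial.eval_C,
      Polynomial.eval_finsetSum, Polynomial.eval_pow, Polynomial.eval_X, zero_pow_eq,
      Finset.sum_boole]
    ring
  · simp

/-- The product `∏_{i=1}^k (n+i-1)↓_n` of falling factorials. -/
def fallingProd (n k : ℕ) : ℕ := ∏ i ∈ Finset.Icc 1 k, (n + i - 1).descFactorial n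

end Filling

/-! Listing the cells by increasing entry turns standard tableaux into linear extensions of a grid.
Removing the smallest cell gives a recursion over the corners of a shape; Frobenius' formula
satisfies the same recursion because of the Vandermonde identity `sum_mul_vandermondeProd_update`.
On a rectangle the formula becomes `card_standardTableaux`.

For the generating functions, give each adjacent pair of columns the weight `x` at a match and `1`
otherwise, and write each weight as `(weight - 1) + 1`. Cutting at the first pair where `1` is
chosen leaves an initial standard block with weight a power of `x - 1`, followed by an arbitrary
filling. The two sides reduce independently once the entries of the block are chosen
(`sum_mul_cols`), so a binomial convolution results (`sum_pow_mch_succ`). It says that `genDInv`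
inverts `genD`; both closed forms follow, the second at `x = 0`. -/

open Finset

/-! ### A Vandermonde identity -/

/-- Replacing each row `i` of `M` by the `i`-th row of `M * D` and adding up the determinants
multiplies the determinant by the trace of `D`. -/
theorem Matrix.sum_det_updateRow_mul {ι R : Type*} [Fintype ι] [DecidableEq ι] [CommRing R]
    (M D : Matrix ι ι R) :
    ∑ i, (M.updateRow i ((M * D) i)).det = D.trace * M.det := by
  -- Cramer's rule: the determinant with row `i` replaced by `v` is entry `i` of `v * adjugate M`.
  have h : ∀ i, (M.updateRow i ((M * D) i)).det = (M * D * M.adjugate) i i := by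
    intro i
    rw [← Matrix.cramer_transpose_apply, Matrix.cramer_eq_adjugate_mulVec,
      ← Matrix.adjugate_transpose, Matrix.mulVec_transpose, Matrix.mul_apply_eq_vecMul,
      Matrix.mul_apply_eq_vecMul, Matrix.mul_apply_eq_vecMul]
  simp_rw [h]
  change (M * D * M.adjugate).trace = _
  rw [Matrix.trace_mul_comm, ← Matrix.mul_assoc, Matrix.adjugate_mul, Matrix.smul_mul,
    Matrix.one_mul, Matrix.trace_smul, smul_eq_mul, mul_comm]

/-- The Vandermonde product `∏_{i < j} (l_j - l_i)`. -/
noncomputable def vandermondeProd {k : ℕ} (l : Fin k → ℚ) : ℚ := (Matrix.vandermonde l).det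

theorem vandermondeProd_eq_det_descPochhammer {k : ℕ} (l : Fin k → ℚ) :
    vandermondeProd l =
      (Matrix.of fun i j : Fin k => (descPochhammer ℚ j).eval (l i)).det :=
  Matrix.det_eval_matrixOfPolynomials_eq_det_vandermonde l _
    (fun i => by simp) (fun i => monic_descPochhammer ℚ i)

theorem vandermondeProd_eq_zero {k : ℕ} (l : Fin k → ℚ) {i j : Fin k} (hij : i ≠ j)
    (h : l i = l j) : vandermondeProd l = 0 := by
  rw [vandermondeProd]
  apply Matrix.det_zero_of_row_eq hij
  ext a
  simp [Matrix.vandermonde_apply, h]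

/-- In the falling factorial basis `p_j`, one has `x * p_j (x - 1) = (x - j) * p_j x`. So scaling
the shifted row by `l i` gives row `i` of `M` minus row `i` of `M * diag(j)`, and the trace lemma
sums the corrections. -/
theorem sum_mul_vandermondeProd_update {k : ℕ} (l : Fin k → ℚ) :
    ∑ i, l i * vandermondeProd (Function.update l i (l i - 1)) =
      (∑ i : Fin k, (l i - i)) * vandermondeProd l := by
  set M : Matrix (Fin k) (Fin k) ℚ :=
    Matrix.of fun i j : Fin k => (descPochhammer ℚ j).eval (l i) with hM
  have key : ∀ i, l i * vandermondeProd (Function.update l i (l i - 1)) =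
      l i * M.det - (M.updateRow i ((M * Matrix.diagonal fun j : Fin k => (j : ℚ)) i)).det := by
    intro i
    have h1 : (Matrix.of fun a j : Fin k =>
        (descPochhammer ℚ j).eval (Function.update l i (l i - 1) a)) =
        M.updateRow i fun j => (descPochhammer ℚ j).eval (l i - 1) := by
      ext a j
      rcases eq_or_ne a i with rfl | h
      · simp
      · simp [h, hM]
    have h2 : (l i • fun j : Fin k => (descPochhammer ℚ j).eval (l i - 1)) =
        l i • M i + (-1 : ℚ) • (M * Matrix.diagonal fun j : Fin k => (j : ℚ)) i := by
      ext j
      -- Both sides are `p_{j+1}`, factored from the left and from the right.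
      have h3 := congrArg (Polynomial.eval (l i)) (descPochhammer_succ_left ℚ (j : ℕ))
      rw [descPochhammer_succ_right] at h3
      simp only [Polynomial.eval_mul, Polynomial.eval_X, Polynomial.eval_comp,
        Polynomial.eval_sub, Polynomial.eval_one, Polynomial.eval_natCast] at h3
      simp only [Pi.smul_apply, smul_eq_mul, Pi.add_apply, Matrix.mul_diagonal, hM,
        Matrix.of_apply]
      rw [← h3]
      ring
    rw [vandermondeProd_eq_det_descPochhammer, h1, ← Matrix.det_updateRow_smul, h2,
      Matrix.det_updateRow_add, Matrix.det_updateRow_smul, Matrix.det_updateRow_smul,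
      Matrix.updateRow_eq_self]
    ring
  simp_rw [key]
  rw [Finset.sum_sub_distrib, Matrix.sum_det_updateRow_mul, Matrix.trace_diagonal,
    Finset.sum_sub_distrib, ← Finset.sum_mul, vandermondeProd_eq_det_descPochhammer]
  ring

/-! ### Linear extensions -/

open Classical in
/-- The orders of removal of the elements of `S` in which no element is removed before a
smaller one. -/
noncomputable def linearExtensions {α : Type*} [Preorder α] (S : Finset α) : Finset (List α) :=
  (⟨S.val.lists, Multiset.lists_nodup_finset S⟩ : Finset (List α)).filter fun l =>
    l.Pairwise fun a b => ¬ b < a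

open Classical in
/-- The minimal elements of `S`. -/
noncomputable def minimalElements {α : Type*} [Preorder α] (S : Finset α) : Finset α :=
  S.filter fun c => ∀ d ∈ S, ¬ d < c

theorem mem_minimalElements {α : Type*} [Preorder α] {S : Finset α} {c : α} :
    c ∈ minimalElements S ↔ c ∈ S ∧ ∀ d ∈ S, ¬ d < c := by
  classical
  rw [minimalElements, Finset.mem_filter]

section LinearExtensions

variable {α : Type*} [Preorder α]

theorem mem_linearExtensions {S : Finset α} {l : List α} :
    l ∈ linearExtensions S ↔
      (l.Nodup ∧ ∀ a, a ∈ l ↔ a ∈ S) ∧ l.Pairwise fun a b => ¬ b < a := by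
  classical
  rw [linearExtensions, Finset.mem_filter, Finset.mem_mk, Multiset.mem_lists_iff]
  refine and_congr_left fun _ => ⟨fun h => ?_, fun h => ?_⟩
  · have h' : S.val = (l : Multiset α) := h
    refine ⟨?_, fun a => ?_⟩
    · rw [← Multiset.coe_nodup, ← h']
      exact S.nodup
    · rw [← Multiset.mem_coe, ← h']
      rfl
  · change S.val = (l : Multiset α)
    exact (Multiset.Nodup.ext S.nodup (Multiset.coe_nodup.2 h.1)).2 fun a => by
      simpa using (h.2 a).symm

theorem linearExtensions_empty : linearExtensions (∅ : Finset α) = {[]} := by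
  ext l
  rw [mem_linearExtensions]
  simp only [Finset.notMem_empty, iff_false, ← List.eq_nil_iff_forall_not_mem,
    Finset.mem_singleton]
  constructor
  · exact fun h => h.1.2
  · rintro rfl
    simp

/-- The first element removed must be minimal, and any minimal element may come first. -/
theorem linearExtensions_eq_biUnion [DecidableEq α] {S : Finset α} (hS : S.Nonempty) :
    linearExtensions S = (minimalElements S).biUnion fun c =>
      (linearExtensions (S.erase c)).map ⟨List.cons c, List.cons_injective⟩ := by
  ext l
  simp only [Finset.mem_biUnion, mem_minimalElements, Finset.mem_map,
    Function.Embedding.coeFn_mk]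
  constructor
  · intro h
    rw [mem_linearExtensions] at h
    obtain ⟨⟨h1, h2⟩, h3⟩ := h
    cases l with
    | nil =>
      obtain ⟨a, ha⟩ := hS
      simpa using (h2 a).2 ha
    | cons c l =>
      rw [List.nodup_cons] at h1
      rw [List.pairwise_cons] at h3
      refine ⟨c, ⟨(h2 c).1 (by simp), fun d hd => ?_⟩, l, ?_, rfl⟩
      · rcases List.mem_cons.1 ((h2 d).2 hd) with rfl | h
        · exact lt_irrefl _
        · exact h3.1 d h
      · rw [mem_linearExtensions]
        refine ⟨⟨h1.2, fun a => ?_⟩, h3.2⟩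
        rw [Finset.mem_erase, ← h2 a, List.mem_cons]
        constructor
        · intro h
          exact ⟨fun hac => h1.1 (hac ▸ h), Or.inr h⟩
        · rintro ⟨h, h' | h'⟩
          · exact absurd h' h
          · exact h'
  · rintro ⟨c, ⟨hc, hmin⟩, l, hl, rfl⟩
    rw [mem_linearExtensions] at hl ⊢
    obtain ⟨⟨h1, h2⟩, h3⟩ := hl
    refine ⟨⟨List.nodup_cons.2 ⟨fun h => by simpa using (h2 c).1 h, h1⟩, fun a => ?_⟩,
      List.pairwise_cons.2 ⟨fun d hd => hmin d (Finset.mem_of_mem_erase ((h2 d).1 hd)), h3⟩⟩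
    rw [List.mem_cons, h2, Finset.mem_erase]
    by_cases h : a = c
    · simp [h, hc]
    · simp [h]

theorem card_linearExtensions [DecidableEq α] {S : Finset α} (hS : S.Nonempty) :
    (linearExtensions S).card =
      ∑ c ∈ minimalElements S, (linearExtensions (S.erase c)).card := by
  rw [linearExtensions_eq_biUnion hS, Finset.card_biUnion]
  · simp
  · intro c _ d _ hcd
    rw [Function.onFun, Finset.disjoint_left]
    simp only [Finset.mem_map, Function.Embedding.coeFn_mk]
    rintro _ ⟨l, _, rfl⟩ ⟨l', _, h⟩
    exact hcd (List.cons.inj h).1.symm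

end LinearExtensions

theorem vandermondeProd_natCast (k : ℕ) :
    vandermondeProd (fun i : Fin k => (i : ℚ)) = ∏ i : Fin k, ((i : ℕ).factorial : ℚ) := by
  cases k with
  | zero => simp [vandermondeProd]
  | succ k =>
    rw [vandermondeProd, Matrix.det_vandermonde_id_eq_superFactorial,
      ← Nat.prod_range_succ_factorial, Fin.prod_univ_eq_prod_range fun i => (i.factorial : ℚ)]
    push_cast
    rfl

theorem vandermondeProd_add_const {k : ℕ} (l : Fin k → ℚ) (a : ℚ) :
    vandermondeProd (fun i => a + l i) = vandermondeProd l := by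
  simp only [vandermondeProd, Matrix.det_vandermonde]
  simp

/-! ### Corners of right-aligned shapes and Frobenius' formula -/

/-- The cells of the `k × n` array whose row `i` consists of its last `μ i` cells. -/
def rightAligned {k : ℕ} (n : ℕ) (μ : Fin k → ℕ) : Finset (Fin k × Fin n) :=
  Finset.univ.filter fun c => n ≤ c.2 + μ c.1

theorem mem_rightAligned {k n : ℕ} {μ : Fin k → ℕ} {c : Fin k × Fin n} :
    c ∈ rightAligned n μ ↔ n ≤ c.2 + μ c.1 := by
  simp [rightAligned]

section Minimal

variable {k n : ℕ} {μ : Fin k → ℕ} {c : Fin k × Fin n}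

theorem col_add_eq_of_minimal (hn : ∀ i, μ i ≤ n) (hc : c ∈ rightAligned n μ)
    (hmin : ∀ d ∈ rightAligned n μ, ¬ d < c) : c.2 + μ c.1 = n := by
  rw [mem_rightAligned] at hc
  by_contra hne
  have h1 := hn c.1
  refine hmin (c.1, ⟨c.2 - 1, by omega⟩) ?_ ?_
  · rw [mem_rightAligned]
    dsimp only
    omega
  · refine Prod.lt_iff.2 (Or.inr ⟨le_rfl, ?_⟩)
    rw [Fin.lt_def]
    dsimp only
    omega

theorem lt_of_minimal (hμ : Monotone μ) (hn : ∀ i, μ i ≤ n) (hc : c ∈ rightAligned n μ)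
    (hmin : ∀ d ∈ rightAligned n μ, ¬ d < c) {a : Fin k} (ha : a < c.1) : μ a < μ c.1 := by
  refine lt_of_le_of_ne (hμ ha.le) fun h => hmin (a, c.2) ?_ ?_
  · rw [mem_rightAligned, h, col_add_eq_of_minimal hn hc hmin]
  · exact Prod.lt_iff.2 (Or.inl ⟨ha, le_rfl⟩)

/-- A cell below would lie in a strictly shorter row, which starts further right. -/
theorem minimal_of_corner {i : Fin k} (h0 : 0 < μ i) (hn : μ i ≤ n)
    (hi : ∀ a < i, μ a < μ i) :
    ((i, ⟨n - μ i, by omega⟩) : Fin k × Fin n) ∈ rightAligned n μ ∧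
      ∀ d ∈ rightAligned n μ, ¬ d < (i, ⟨n - μ i, by omega⟩) := by
  refine ⟨?_, fun d hd hlt => ?_⟩
  · rw [mem_rightAligned]
    dsimp only
    omega
  · rw [mem_rightAligned] at hd
    rcases Prod.lt_iff.1 hlt with ⟨h1, h2⟩ | ⟨h1, h2⟩
    · have := hi _ h1
      rw [Fin.le_def] at h2
      dsimp only at h2
      omega
    · rw [Fin.lt_def] at h2
      dsimp only at h1 h2
      rcases h1.lt_or_eq with h | h
      · have := hi _ h
        omega
      · rw [h] at hd
        omega

theorem monotone_update_of_minimal (hμ : Monotone μ) (hn : ∀ i, μ i ≤ n)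
    (hc : c ∈ rightAligned n μ) (hmin : ∀ d ∈ rightAligned n μ, ¬ d < c) :
    Monotone (Function.update μ c.1 (μ c.1 - 1)) := by
  intro a b hab
  have h1 := hμ hab
  rcases hab.lt_or_eq with h | rfl
  · rcases eq_or_ne a c.1 with rfl | ha
    · rw [Function.update_self, Function.update_of_ne h.ne']
      omega
    · rw [Function.update_of_ne ha]
      rcases eq_or_ne b c.1 with rfl | hb
      · have := lt_of_minimal hμ hn hc hmin h
        rw [Function.update_self]
        omega
      · rwa [Function.update_of_ne hb]
  · rfl

theorem erase_rightAligned (hn : ∀ i, μ i ≤ n)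
    (hc : c ∈ rightAligned n μ) (hmin : ∀ d ∈ rightAligned n μ, ¬ d < c) :
    (rightAligned n μ).erase c = rightAligned n (Function.update μ c.1 (μ c.1 - 1)) := by
  have h := col_add_eq_of_minimal hn hc hmin
  ext d
  rw [Finset.mem_erase, mem_rightAligned, mem_rightAligned]
  rcases eq_or_ne d.1 c.1 with h1 | h1
  · rw [h1, Function.update_self, Ne, Prod.ext_iff, Fin.ext_iff (a := d.2)]
    have := c.2.2
    simp only [h1, true_and]
    omega
  · rw [Function.update_of_ne h1, Ne, Prod.ext_iff]
    simp [h1]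

end Minimal

/-- The summand of `sum_mul_vandermondeProd_update` at a row without removable cell vanishes. -/
theorem mul_vandermondeProd_update_eq_zero {k : ℕ} {μ : Fin k → ℕ} (hμ : Monotone μ) {i : Fin k}
    (hi : μ i = 0 ∨ ∃ a < i, μ a = μ i) :
    ((μ i : ℚ) + i) * vandermondeProd
      (Function.update (fun a : Fin k => (μ a : ℚ) + a) i ((μ i : ℚ) + i - 1)) = 0 := by
  -- In the bottom row the prefactor is zero; in any other row the decreased entry collides with
  -- that of the row below.
  by_cases h0 : i.1 = 0
  · rcases hi with h | ⟨a, ha, -⟩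
    · simp [h, h0]
    · rw [Fin.lt_def] at ha
      omega
  · set b : Fin k := ⟨i - 1, by omega⟩ with hb
    have hbi : b < i := by
      rw [Fin.lt_def, hb]
      dsimp only
      omega
    have hμb : μ b = μ i := by
      apply le_antisymm (hμ hbi.le)
      rcases hi with h | ⟨a, ha, h⟩
      · omega
      · rw [← h]
        apply hμ
        rw [Fin.lt_def] at ha
        rw [Fin.le_def, hb]
        dsimp only
        omega
    rw [vandermondeProd_eq_zero _ hbi.ne, mul_zero]
    rw [Function.update_of_ne hbi.ne, Function.update_self, hμb, hb]
    dsimp only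
    rw [Nat.cast_sub (by omega)]
    push_cast
    ring

theorem prod_factorial_update {k : ℕ} (l : Fin k → ℕ) {i : Fin k} (h : 0 < l i) :
    ∏ a, (l a).factorial = l i * ∏ a, (Function.update l i (l i - 1) a).factorial := by
  rw [← Finset.mul_prod_erase _ _ (Finset.mem_univ i),
    ← Finset.mul_prod_erase _ (fun a => (Function.update l i (l i - 1) a).factorial)
      (Finset.mem_univ i), Function.update_self, ← mul_assoc, Nat.mul_factorial_pred h.ne']
  congr 1
  apply Finset.prod_congr rfl
  intro a ha
  rw [Function.update_of_ne (Finset.ne_of_mem_erase ha)]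

/-- Frobenius' formula for the number of standard tableaux, here of a right-aligned shape. -/
theorem card_linearExtensions_rightAligned {k n : ℕ} (N : ℕ) (μ : Fin k → ℕ) (hμ : Monotone μ)
    (hn : ∀ i, μ i ≤ n) (hN : ∑ i, μ i = N) :
    ((linearExtensions (rightAligned n μ)).card : ℚ) =
      N.factorial * vandermondeProd (fun i => (μ i : ℚ) + i) /
        ((∏ i, (μ i + i).factorial : ℕ) : ℚ) := by
  induction N generalizing μ with
  | zero =>
    have h0 : ∀ i, μ i = 0 := by simpa using hN
    have he : rightAligned n μ = ∅ := by
      ext c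
      have := c.2.2
      simp [mem_rightAligned, h0]
    have hp : ((∏ i : Fin k, (i : ℕ).factorial : ℕ) : ℚ) ≠ 0 :=
      Nat.cast_ne_zero.2 (Finset.prod_ne_zero_iff.2 fun i _ => Nat.factorial_ne_zero _)
    simp only [he, linearExtensions_empty, h0, Nat.cast_zero, zero_add, vandermondeProd_natCast]
    push_cast at hp ⊢
    simp [div_self hp]
  | succ N ih =>
    have hne : (rightAligned n μ).Nonempty := by
      obtain ⟨i, -, hi⟩ : ∃ i ∈ Finset.univ, μ i ≠ 0 := by
        apply Finset.exists_ne_zero_of_sum_ne_zero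
        omega
      have := hn i
      refine ⟨(i, ⟨n - 1, by omega⟩), ?_⟩
      rw [mem_rightAligned]
      dsimp only
      omega
    have hp : ((∏ i, (μ i + i).factorial : ℕ) : ℚ) ≠ 0 :=
      Nat.cast_ne_zero.2 (Finset.prod_ne_zero_iff.2 fun i _ => Nat.factorial_ne_zero _)
    have hsum := sum_mul_vandermondeProd_update fun i => (μ i : ℚ) + i
    have hN' : ∑ i : Fin k, ((μ i : ℚ) + i - i) = N + 1 := by
      simp only [add_sub_cancel_right]
      exact_mod_cast hN
    rw [hN'] at hsum
    rw [card_linearExtensions hne, Nat.factorial_succ, Nat.cast_mul, Nat.cast_succ,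
      mul_comm ((N : ℚ) + 1), mul_assoc, ← hsum, Finset.mul_sum, Finset.sum_div, Nat.cast_sum]
    -- A row has at most one minimal cell, so the sum over minimal cells is a sum over rows; the
    -- remaining rows contribute zero.
    refine Finset.sum_of_injOn Prod.fst ?_ (fun _ _ => Finset.mem_coe.2 (Finset.mem_univ _)) ?_ ?_
    · intro c hc d hd hcd
      rw [Finset.mem_coe, mem_minimalElements] at hc hd
      have h1 := col_add_eq_of_minimal hn hc.1 hc.2
      have h2 := col_add_eq_of_minimal hn hd.1 hd.2
      rw [← hcd] at h2
      exact Prod.ext hcd (Fin.ext (by omega))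
    · intro i _ hi
      rw [mul_vandermondeProd_update_eq_zero hμ, mul_zero, zero_div]
      by_contra! h
      obtain ⟨h1, h2⟩ := minimal_of_corner (Nat.pos_of_ne_zero h.1) (hn i)
        fun a ha => lt_of_le_of_ne (hμ ha.le) (h.2 a ha)
      exact hi ⟨_, Finset.mem_coe.2 (mem_minimalElements.2 ⟨h1, h2⟩), rfl⟩
    · intro c hc
      obtain ⟨hc, hmin⟩ := mem_minimalElements.1 hc
      have hcol := col_add_eq_of_minimal hn hc hmin
      have hpos : 0 < μ c.1 := by
        have := c.2.2
        omega
      have hl : ∀ a : Fin k, Function.update μ c.1 (μ c.1 - 1) a + (a : ℕ) =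
          Function.update (fun a : Fin k => μ a + (a : ℕ)) c.1 (μ c.1 + c.1 - 1) a := by
        intro a
        rcases eq_or_ne a c.1 with rfl | h
        · simp only [Function.update_self]
          omega
        · simp only [Function.update_of_ne h]
      have hlq : (fun a : Fin k => ((Function.update μ c.1 (μ c.1 - 1) a : ℕ) : ℚ) + a) =
          Function.update (fun a : Fin k => (μ a : ℚ) + a) c.1 ((μ c.1 : ℚ) + c.1 - 1) := by
        ext a
        rcases eq_or_ne a c.1 with rfl | h
        · simp only [Function.update_self]
          rw [Nat.cast_sub hpos]
          push_cast
          ring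
        · simp only [Function.update_of_ne h]
      -- The factor lost by the factorials cancels the weight `l i` in the Vandermonde identity.
      have hprod := prod_factorial_update (fun a : Fin k => μ a + (a : ℕ)) (i := c.1) (by omega)
      rw [erase_rightAligned hn hc hmin, ih _ (monotone_update_of_minimal hμ hn hc hmin), hlq]
      · simp_rw [hl]
        rw [hprod] at hp ⊢
        rw [Nat.cast_mul] at hp ⊢
        rw [mul_left_comm, Nat.cast_add, mul_div_mul_left]
        rw [← Nat.cast_add]
        exact left_ne_zero_of_mul hp
      · intro i
        rcases eq_or_ne i c.1 with rfl | h
        · have := hn c.1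
          rw [Function.update_self]
          omega
        · rw [Function.update_of_ne h]
          exact hn i
      · rw [Finset.sum_update_of_mem (Finset.mem_univ _)]
        rw [← Finset.add_sum_erase _ _ (Finset.mem_univ c.1), ← Finset.sdiff_singleton_eq_erase] at hN
        omega

/-! ### Counting rectangular standard tableaux -/

namespace Filling

theorem mem_standardTableaux_iff_strictMono {n k : ℕ} {F : Filling n k} :
    F ∈ standardTableaux n k ↔ StrictMono F.1 := by
  rw [standardTableaux, Finset.mem_filter]
  constructor
  · rintro ⟨-, h⟩ ⟨a, b⟩ ⟨c, d⟩ hlt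
    have hle := hlt.le
    rw [Prod.mk_le_mk] at hle
    have h1 : F.1 (a, b) ≤ F.1 (c, b) := by
      rcases hle.1.lt_or_eq with h' | rfl
      · exact (F.2 b a c h').le
      · rfl
    have h2 : F.1 (c, b) ≤ F.1 (c, d) := by
      rcases hle.2.lt_or_eq with h' | rfl
      · exact (h c b d h').le
      · rfl
    exact lt_of_le_of_ne (h1.trans h2) (F.1.injective.ne hlt.ne)
  · exact fun h => ⟨Finset.mem_univ _, fun i a b hab => h (Prod.mk_lt_mk.2 (Or.inr ⟨le_rfl, hab⟩))⟩

/-- The inverse of a tableau lists the cells by increasing entry. -/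
theorem card_standardTableaux_eq_card_linearExtensions (n k : ℕ) :
    (standardTableaux n k).card =
      (linearExtensions (Finset.univ : Finset (Fin k × Fin n))).card := by
  refine Finset.card_bij (fun F _ => List.ofFn F.1.symm) ?_ ?_ ?_
  · intro F hF
    rw [mem_standardTableaux_iff_strictMono] at hF
    rw [mem_linearExtensions, List.nodup_ofFn, List.pairwise_ofFn]
    refine ⟨⟨F.1.symm.injective, fun c => ?_⟩, fun i j hij h => ?_⟩
    · simpa [List.mem_ofFn] using ⟨F.1 c, F.1.symm_apply_apply c⟩
    · have := hF h
      simp only [Equiv.apply_symm_apply] at this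
      exact lt_asymm hij this
  · intro F _ G _ h
    apply Subtype.ext
    rw [← Equiv.symm_bijective.injective.eq_iff]
    exact DFunLike.coe_injective (List.ofFn_injective h)
  · intro l hl
    rw [mem_linearExtensions] at hl
    obtain ⟨⟨h1, h2⟩, h3⟩ := hl
    set e := h1.getEquivOfForallMemList l fun c => (h2 c).2 (Finset.mem_univ c) with he
    have hlen : l.length = k * n := by
      simpa using Fintype.card_congr e
    have hmono : ∀ c d, c < d → e.symm c < e.symm d := by
      intro c d hcd
      by_contra hle
      have hlt : e.symm d < e.symm c :=
        lt_of_le_of_ne (not_lt.1 hle) (e.symm.injective.ne hcd.ne')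
      have h4 := List.pairwise_iff_get.1 h3 _ _ hlt
      have h5 : ∀ c, l.get (e.symm c) = c := e.apply_symm_apply
      rw [h5, h5] at h4
      exact h4 hcd
    let F : Fin k × Fin n ≃ Fin (k * n) := e.symm.trans (finCongr hlen)
    have hF : StrictMono F := fun c d hcd => by
      have := hmono c d hcd
      rw [Fin.lt_def] at this ⊢
      simpa [F] using this
    refine ⟨⟨F, fun j a b hab => hF (Prod.mk_lt_mk.2 (Or.inl ⟨hab, le_rfl⟩))⟩,
      mem_standardTableaux_iff_strictMono.2 hF, ?_⟩
    apply List.ext_get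
    · simp [hlen]
    · intro i _ _
      simp [F, he]

/-- Converts the factorial quotient in Frobenius' formula for a rectangle into falling factorials.
-/
theorem fallingProd_mul_prod_factorial (n k : ℕ) :
    fallingProd n k * ∏ i : Fin k, (i : ℕ).factorial = ∏ i : Fin k, (n + i).factorial := by
  rw [Fin.prod_univ_eq_prod_range fun i => i.factorial,
    Fin.prod_univ_eq_prod_range fun i => (n + i).factorial, fallingProd,
    ← Finset.Ico_add_one_right_eq_Icc, Finset.prod_Ico_eq_prod_range, Nat.add_sub_cancel, ← Finset.prod_mul_distrib]
  apply Finset.prod_congr rfl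
  intro i _
  rw [show n + (1 + i) - 1 = n + i by omega, mul_comm]
  have := Nat.factorial_mul_descFactorial (Nat.le_add_right n i)
  rwa [Nat.add_sub_cancel_left] at this

theorem fallingProd_ne_zero (n k : ℕ) : fallingProd n k ≠ 0 :=
  left_ne_zero_of_mul (b := ∏ i : Fin k, (i : ℕ).factorial) <| by
    rw [fallingProd_mul_prod_factorial]
    exact Finset.prod_ne_zero_iff.2 fun i _ => Nat.factorial_ne_zero _

theorem card_standardTableaux (n k : ℕ) :
    ((standardTableaux n k).card : ℚ) =
      ((k * n).factorial : ℚ) / (fallingProd n k : ℚ) := by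
  have h : (Finset.univ : Finset (Fin k × Fin n)) = rightAligned n fun _ => n := by
    ext c
    simp [mem_rightAligned]
  have hf : (∏ i : Fin k, ((i : ℕ).factorial : ℚ)) ≠ 0 :=
    Finset.prod_ne_zero_iff.2 fun i _ => Nat.cast_ne_zero.2 (Nat.factorial_ne_zero _)
  rw [card_standardTableaux_eq_card_linearExtensions, h,
    card_linearExtensions_rightAligned (k * n) _ monotone_const (fun _ => le_rfl) (by simp),
    vandermondeProd_add_const, vandermondeProd_natCast, ← fallingProd_mul_prod_factorial]
  push_cast
  rw [mul_div_mul_right _ _ hf]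

end Filling

/-! ### Matches as comparisons of adjacent columns -/

theorem Fin.strictMono_iff_forall_lt_succ {m : ℕ} {α : Type*} [Preorder α] {f : Fin m → α} :
    StrictMono f ↔ ∀ i (h : i + 1 < m), f ⟨i, by omega⟩ < f ⟨i + 1, h⟩ := by
  cases m with
  | zero => exact ⟨fun _ i h => absurd h (by omega), fun _ a => a.elim0⟩
  | succ m =>
    rw [Fin.strictMono_iff_lt_succ]
    exact ⟨fun h i hi => h ⟨i, by omega⟩, fun h i => h i (by omega)⟩

namespace Filling

theorem rank_lt_rank_iff {m k N : ℕ} {G : Fin k × Fin m → Fin N} {c d : Fin k × Fin m} :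
    rank G c < rank G d ↔ G c < G d := by
  refine ⟨fun h => ?_, rank_lt_rank G⟩
  rcases lt_trichotomy (G c) (G d) with hlt | heq | hgt
  · exact hlt
  · simp [rank, heq] at h
  · exact absurd h (rank_lt_rank G hgt).not_gt

theorem red_lt_red_iff {m k N : ℕ} {G : Fin k × Fin m → Fin N} {hG : Function.Injective G}
    {hcol : ∀ (j : Fin m) (a b : Fin k), a < b → G (a, j) < G (b, j)} {c d : Fin k × Fin m} :
    (red G hG hcol).1 c < (red G hG hcol).1 d ↔ G c < G d := by
  rw [← rank_lt_rank_iff (G := G), Fin.lt_def]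
  rfl

theorem mem_standardTableaux_iff {n k : ℕ} {F : Filling n k} :
    F ∈ standardTableaux n k ↔
      ∀ i (h : i + 1 < n) (r : Fin k), F.1 (r, ⟨i, by omega⟩) < F.1 (r, ⟨i + 1, h⟩) := by
  rw [standardTableaux, Finset.mem_filter]
  simp only [Finset.mem_univ, true_and]
  have h : ∀ r : Fin k, (∀ a b : Fin n, a < b → F.1 (r, a) < F.1 (r, b)) ↔
      StrictMono fun a => F.1 (r, a) := fun r => Iff.rfl
  simp_rw [h, Fin.strictMono_iff_forall_lt_succ]
  exact ⟨fun h i hi r => h r i hi, fun h r i hi => h i hi r⟩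

/-- The reduction of `j` consecutive columns of `F`, starting with column `i`. -/
noncomputable def cols {n k : ℕ} (F : Filling n k) (j i : ℕ) (h : i + j ≤ n) : Filling j k :=
  red (window F j i h) (window_injective F j i h) fun _ a b hab => F.2 _ a b hab

theorem cols_lt_cols_iff {n k : ℕ} {F : Filling n k} {j i : ℕ} {h : i + j ≤ n}
    {c d : Fin k × Fin j} :
    (cols F j i h).1 c < (cols F j i h).1 d ↔
      F.1 (c.1, ⟨i + c.2, by omega⟩) < F.1 (d.1, ⟨i + d.2, by omega⟩) :=
  red_lt_red_iff

theorem hasMatchAt_standardTableaux {n k : ℕ} {F : Filling n k} {i : ℕ} :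
    HasMatchAt (standardTableaux 2 k) F i ↔
      ∃ h : i + 1 < n, ∀ r : Fin k, F.1 (r, ⟨i, by omega⟩) < F.1 (r, ⟨i + 1, h⟩) := by
  have key : ∀ h : i + 2 ≤ n, cols F 2 i h ∈ standardTableaux 2 k ↔
      ∀ r : Fin k, F.1 (r, ⟨i, by omega⟩) < F.1 (r, ⟨i + 1, by omega⟩) := by
    intro h
    rw [mem_standardTableaux_iff]
    simp_rw [cols_lt_cols_iff]
    refine ⟨fun H r => H 0 (by omega) r, fun H a ha r => ?_⟩
    obtain rfl : a = 0 := by omega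
    exact H r
  exact ⟨fun ⟨h, H⟩ => ⟨h, (key h).1 H⟩, fun ⟨h, H⟩ => ⟨h, (key h).2 H⟩⟩

/-- Rows increase as soon as adjacent entries do, and reduction preserves comparisons. -/
theorem cols_mem_standardTableaux {n k : ℕ} {F : Filling n k} {j i : ℕ} {h : i + j ≤ n} :
    cols F j i h ∈ standardTableaux j k ↔
      ∀ a, a + 1 < j → HasMatchAt (standardTableaux 2 k) F (i + a) := by
  rw [mem_standardTableaux_iff]
  simp_rw [cols_lt_cols_iff, hasMatchAt_standardTableaux]
  exact ⟨fun H a ha => ⟨by omega, H a ha⟩, fun H a ha => (H a ha).2⟩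

theorem hasMatchAt_cols {n k : ℕ} {F : Filling n k} {j i : ℕ} {h : i + j ≤ n} {a : ℕ}
    (ha : a + 1 < j) :
    HasMatchAt (standardTableaux 2 k) (cols F j i h) a ↔
      HasMatchAt (standardTableaux 2 k) F (i + a) := by
  simp_rw [hasMatchAt_standardTableaux, cols_lt_cols_iff]
  exact ⟨fun ⟨_, H⟩ => ⟨by omega, H⟩, fun ⟨_, H⟩ => ⟨ha, H⟩⟩

open Classical in
theorem mch_eq_card_filter_range_pred {n k : ℕ} (F : Filling n k) :
    mch (standardTableaux 2 k) F =
      ((Finset.range (n - 1)).filter fun i => HasMatchAt (standardTableaux 2 k) F i).card := by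
  rw [mch]
  congr 1
  ext i
  rw [Finset.mem_filter, Finset.mem_filter, Finset.mem_range, Finset.mem_range]
  refine and_congr_left fun h => ?_
  have := (hasMatchAt_standardTableaux.1 h).1
  omega

theorem mch_add_one_eq_iff {n k : ℕ} (hn : 1 ≤ n) {F : Filling n k} :
    mch (standardTableaux 2 k) F + 1 = n ↔ F ∈ standardTableaux n k := by
  classical
  have h : mch (standardTableaux 2 k) F + 1 = n ↔
      mch (standardTableaux 2 k) F = (Finset.range (n - 1)).card := by
    rw [Finset.card_range]
    omega
  rw [h, mch_eq_card_filter_range_pred, Finset.card_filter_eq_iff, mem_standardTableaux_iff]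
  simp_rw [hasMatchAt_standardTableaux]
  exact ⟨fun H i hi => (H i (Finset.mem_range.2 (by omega))).2,
    fun H i hi => ⟨by have := Finset.mem_range.1 hi; omega,
      H i (by have := Finset.mem_range.1 hi; omega)⟩⟩

theorem full_standardTableaux {n : ℕ} (hn : 1 ≤ n) (k : ℕ) :
    full (standardTableaux 2 k) n = (standardTableaux n k).card := by
  rw [full]
  congr 1
  ext F
  rw [Finset.mem_filter, mch_add_one_eq_iff hn]
  simp

/-! ### Splitting a filling into two blocks of columns -/

theorem rank_strictMono_comp {m k N : ℕ} {g : Fin (k * m) → Fin N} (hg : StrictMono g)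
    (P : Fin k × Fin m ≃ Fin (k * m)) (c : Fin k × Fin m) :
    rank (fun d => g (P d)) c = P c := by
  simp only [rank, hg.lt_iff_lt]
  rw [← Fin.card_Iio (P c)]
  exact Finset.card_equiv P (by simp)

theorem red_strictMono_comp {m k N : ℕ} {g : Fin (k * m) → Fin N} (hg : StrictMono g)
    (P : Filling m k) {G : Fin k × Fin m → Fin N} (h : G = fun d => g (P.1 d))
    (hG : Function.Injective G)
    (hcol : ∀ (j : Fin m) (a b : Fin k), a < b → G (a, j) < G (b, j)) :
    red G hG hcol = P := by
  subst h
  apply Subtype.ext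
  ext c
  exact rank_strictMono_comp hg P.1 c

/-- Reading `G` in the order of its reduction is a strictly increasing map into `S`, and by
cardinality there is only one. -/
theorem eq_orderEmbOfFin_red {m k N : ℕ} {G : Fin k × Fin m → Fin N} (hG : Function.Injective G)
    (hcol : ∀ (j : Fin m) (a b : Fin k), a < b → G (a, j) < G (b, j)) {S : Finset (Fin N)}
    (hS : S.card = k * m) (hGS : ∀ c, G c ∈ S) (c : Fin k × Fin m) :
    G c = S.orderEmbOfFin hS ((red G hG hcol).1 c) := by
  have h := Finset.orderEmbOfFin_unique hS (f := fun x => G ((red G hG hcol).1.symm x))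
    (fun x => hGS _) (fun x y hxy => by
      rw [← red_lt_red_iff (hG := hG) (hcol := hcol)]
      simpa using hxy)
  have h' := congrFun h ((red G hG hcol).1 c)
  simpa using h'

section Split

variable {j m k : ℕ}

/-- The set of entries in the first `j` columns. -/
def leftEntries (F : Filling (j + m) k) : Finset (Fin (k * (j + m))) :=
  Finset.univ.image (window F j 0 (by omega))

theorem card_leftEntries (F : Filling (j + m) k) : (leftEntries F).card = k * j := by
  rw [leftEntries, Finset.card_image_of_injective _ (window_injective F j 0 _)]
  simp

theorem window_mem_leftEntries (F : Filling (j + m) k) (c : Fin k × Fin j) :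
    window F j 0 (by omega) c ∈ leftEntries F :=
  Finset.mem_image_of_mem _ (Finset.mem_univ c)

theorem window_mem_compl_leftEntries (F : Filling (j + m) k) (c : Fin k × Fin m) :
    window F m j le_rfl c ∈ (leftEntries F)ᶜ := by
  rw [Finset.mem_compl, leftEntries, Finset.mem_image]
  rintro ⟨d, -, h⟩
  have h' := congrArg (fun x : Fin k × Fin (j + m) => (x.2 : ℕ)) (F.1.injective h)
  dsimp only at h'
  omega

theorem card_compl_eq {S : Finset (Fin (k * (j + m)))} (hS : S.card = k * j) :
    Sᶜ.card = k * m := by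
  rw [Finset.card_compl, hS, Fintype.card_fin, mul_add, Nat.add_sub_cancel_left]

/-- The values of the array whose first `j` columns reduce to `P` and have the entries `S`, and
whose other columns reduce to `Q`. -/
def glueFun (S : Finset (Fin (k * (j + m)))) (hS : S.card = k * j) (P : Filling j k)
    (Q : Filling m k) (c : Fin k × Fin (j + m)) : Fin (k * (j + m)) :=
  if h : c.2 < j then S.orderEmbOfFin hS (P.1 (c.1, ⟨c.2, h⟩))
  else Sᶜ.orderEmbOfFin (card_compl_eq hS) (Q.1 (c.1, ⟨c.2 - j, by omega⟩))

theorem glueFun_injective (S : Finset (Fin (k * (j + m)))) (hS : S.card = k * j)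
    (P : Filling j k) (Q : Filling m k) : Function.Injective (glueFun S hS P Q) := by
  have hdisj : ∀ x y, S.orderEmbOfFin hS x ≠ Sᶜ.orderEmbOfFin (card_compl_eq hS) y := by
    intro x y h
    have h1 := Finset.orderEmbOfFin_mem Sᶜ (card_compl_eq hS) y
    rw [← h, Finset.mem_compl] at h1
    exact h1 (Finset.orderEmbOfFin_mem S hS x)
  rintro ⟨a, b⟩ ⟨c, d⟩ h
  simp only [glueFun] at h
  split_ifs at h with h1 h2 h2
  · have := P.1.injective ((S.orderEmbOfFin hS).injective h)
    simp only [Prod.mk.injEq, Fin.mk.injEq] at this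
    exact Prod.ext this.1 (Fin.ext this.2)
  · exact absurd h (hdisj _ _)
  · exact absurd h.symm (hdisj _ _)
  · have := Q.1.injective ((Sᶜ.orderEmbOfFin (card_compl_eq hS)).injective h)
    simp only [Prod.mk.injEq, Fin.mk.injEq] at this
    exact Prod.ext this.1 (Fin.ext (by dsimp only; omega))

/-- The filling whose first `j` columns reduce to `P` and have the entries `S`, and whose other
columns reduce to `Q`. -/
noncomputable def glue (S : Finset (Fin (k * (j + m)))) (hS : S.card = k * j) (P : Filling j k)
    (Q : Filling m k) : Filling (j + m) k :=
  ⟨Equiv.ofBijective (glueFun S hS P Q) ((Fintype.bijective_iff_injective_and_card _).2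
    ⟨glueFun_injective S hS P Q, by simp⟩), fun i a b hab => by
      simp only [Equiv.ofBijective_apply, glueFun]
      split_ifs with h
      · exact (S.orderEmbOfFin hS).strictMono (P.2 _ _ _ hab)
      · exact (Sᶜ.orderEmbOfFin (card_compl_eq hS)).strictMono (Q.2 _ _ _ hab)⟩

theorem window_glue_left (S : Finset (Fin (k * (j + m)))) (hS : S.card = k * j)
    (P : Filling j k) (Q : Filling m k) :
    window (glue S hS P Q) j 0 (by omega) = fun c => S.orderEmbOfFin hS (P.1 c) := by
  ext c
  simp [window, glue, glueFun]

theorem window_glue_right (S : Finset (Fin (k * (j + m)))) (hS : S.card = k * j)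
    (P : Filling j k) (Q : Filling m k) :
    window (glue S hS P Q) m j le_rfl =
      fun c => Sᶜ.orderEmbOfFin (card_compl_eq hS) (Q.1 c) := by
  ext c
  simp [window, glue, glueFun]

theorem leftEntries_glue (S : Finset (Fin (k * (j + m)))) (hS : S.card = k * j)
    (P : Filling j k) (Q : Filling m k) : leftEntries (glue S hS P Q) = S := by
  apply Finset.eq_of_subset_of_card_le
  · intro x hx
    rw [leftEntries, window_glue_left, Finset.mem_image] at hx
    obtain ⟨c, -, rfl⟩ := hx
    exact Finset.orderEmbOfFin_mem S hS _
  · rw [card_leftEntries, hS]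

/-- A filling is determined by the set of entries in its first columns and the reductions of
the first and of the remaining columns. -/
noncomputable def splitEquiv (j m k : ℕ) : Filling (j + m) k ≃
    {S : Finset (Fin (k * (j + m))) // S.card = k * j} × Filling j k × Filling m k where
  toFun F := (⟨leftEntries F, card_leftEntries F⟩, cols F j 0 (by omega), cols F m j le_rfl)
  invFun x := glue x.1.1 x.1.2 x.2.1 x.2.2
  left_inv F := by
    apply Subtype.ext
    ext ⟨r, i⟩ : 1
    change glueFun _ _ _ _ _ = _
    simp only [glueFun]
    split_ifs with h
    · refine (eq_orderEmbOfFin_red _ _ _ (window_mem_leftEntries F) _).symm.trans ?_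
      simp [window]
    · refine (eq_orderEmbOfFin_red _ _ _ (window_mem_compl_leftEntries F) _).symm.trans ?_
      simp only [window]
      congr 3
      omega
  right_inv x := by
    obtain ⟨⟨S, hS⟩, P, Q⟩ := x
    refine Prod.ext (Subtype.ext (leftEntries_glue S hS P Q)) (Prod.ext ?_ ?_)
    · exact red_strictMono_comp (S.orderEmbOfFin hS).strictMono P
        (window_glue_left S hS P Q) (window_injective _ _ _ _) fun _ a b hab =>
          (glue S hS P Q).2 _ a b hab
    · exact red_strictMono_comp (Sᶜ.orderEmbOfFin (card_compl_eq hS)).strictMono Q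
        (window_glue_right S hS P Q) (window_injective _ _ _ _) fun _ a b hab =>
          (glue S hS P Q).2 _ a b hab

/-- Under `splitEquiv` the entry set is free and the summand ignores it, whence the binomial
coefficient. -/
theorem sum_mul_cols {R : Type*} [CommSemiring R] {n : ℕ} (hn : j + m = n)
    (φ : Filling j k → R) (ψ : Filling m k → R) :
    ∑ F : Filling n k, φ (cols F j 0 (by omega)) * ψ (cols F m j hn.le) =
      ((k * n).choose (k * j) : R) * ((∑ P, φ P) * ∑ Q, ψ Q) := by
  subst hn
  have h := Fintype.sum_equiv (splitEquiv j m k)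
    (fun F => φ (cols F j 0 (by omega)) * ψ (cols F m j le_rfl))
    (fun x => φ x.2.1 * ψ x.2.2) (fun F => rfl)
  rw [h, Fintype.sum_prod_type]
  dsimp only
  rw [Finset.sum_const, Fintype.sum_prod_type, ← Fintype.sum_mul_sum,
    nsmul_eq_mul, Finset.card_univ, Fintype.card_finset_len, Fintype.card_fin]

end Split

end Filling

/-! ### The recurrence for the match enumerator -/

/-- Expanding `∏ (w i - 1 + 1)` by the first index at which the summand `1` is chosen. -/
theorem Finset.prod_range_eq_sum_prod_sub_one {R : Type*} [CommRing R] (w : ℕ → R) (m : ℕ) :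
    ∏ i ∈ range m, w i =
      ∑ j ∈ range (m + 1), (∏ i ∈ range j, (w i - 1)) * ∏ i ∈ range (m - (j + 1)), w (j + 1 + i) := by
  -- The term `j = m` stands for never choosing `1`; its second product is empty by truncated
  -- subtraction.
  induction m generalizing w with
  | zero => simp
  | succ m ih =>
    rw [Finset.sum_range_succ', Finset.prod_range_succ', ih fun i => w (i + 1)]
    have h : ∀ j, (∏ i ∈ range (j + 1), (w i - 1)) *
        ∏ i ∈ range (m + 1 - (j + 1 + 1)), w (j + 1 + 1 + i) =
        (w 0 - 1) * ((∏ i ∈ range j, (w (i + 1) - 1)) *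
          ∏ i ∈ range (m - (j + 1)), w (j + 1 + i + 1)) := by
      intro j
      rw [Finset.prod_range_succ', Nat.add_sub_add_right]
      simp_rw [add_right_comm (j + 1) 1]
      ring
    simp_rw [h]
    rw [← Finset.mul_sum, ← ih fun i => w (i + 1)]
    simp only [range_zero, prod_empty, one_mul, zero_add, Nat.add_sub_cancel, add_comm 1]
    ring

namespace Filling

open Classical in
theorem pow_mch {R : Type*} [CommSemiring R] (x : R) {n k : ℕ} (F : Filling n k) :
    x ^ mch (standardTableaux 2 k) F =
      ∏ i ∈ range (n - 1), if HasMatchAt (standardTableaux 2 k) F i then x else 1 := by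
  rw [mch_eq_card_filter_range_pred, Finset.prod_ite]
  simp

-- A weight minus one is `x - 1` at a match and `0` elsewhere, so the first `p.1 + 1` columns must
-- form a standard block. Position `p.1`, between the block and the other `p.2` columns, is
-- unconstrained.
open Classical in
theorem pow_mch_eq_sum {R : Type*} [CommRing R] (x : R) {n k : ℕ} (F : Filling (n + 1) k) :
    x ^ mch (standardTableaux 2 k) F =
      ∑ p ∈ antidiagonal n, (x - 1) ^ p.1 *
        ((if ∀ a, a < p.1 → HasMatchAt (standardTableaux 2 k) F a then 1 else 0) *
        ∏ i ∈ range (p.2 - 1),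
          if HasMatchAt (standardTableaux 2 k) F (p.1 + 1 + i) then x else 1) := by
  rw [pow_mch, Nat.add_sub_cancel, Finset.prod_range_eq_sum_prod_sub_one,
    Finset.Nat.sum_antidiagonal_eq_sum_range_succ_mk]
  apply Finset.sum_congr rfl
  intro j _
  rw [← mul_assoc, Nat.sub_sub]
  congr 1
  have h : ∀ i, (if HasMatchAt (standardTableaux 2 k) F i then x else 1) - 1 =
      (x - 1) * if HasMatchAt (standardTableaux 2 k) F i then 1 else 0 := by
    intro i
    split_ifs <;> simp
  simp_rw [h]
  rw [Finset.prod_mul_distrib, Finset.prod_const, Finset.card_range, Finset.prod_boole]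
  simp

theorem sum_pow_mch_succ {R : Type*} [CommRing R] (x : R) (n k : ℕ) :
    ∑ F : Filling (n + 1) k, x ^ mch (standardTableaux 2 k) F =
      ∑ p ∈ antidiagonal n, (x - 1) ^ p.1 *
        (((k * (n + 1)).choose (k * (p.1 + 1)) : R) *
          (((standardTableaux (p.1 + 1) k).card : R) *
            ∑ G : Filling p.2 k, x ^ mch (standardTableaux 2 k) G)) := by
  classical
  simp_rw [pow_mch_eq_sum]
  rw [Finset.sum_comm]
  refine Finset.sum_congr rfl fun p hp => ?_
  have hp' := mem_antidiagonal.1 hp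
  have hsum := sum_mul_cols (k := k) (show p.1 + 1 + p.2 = n + 1 by omega)
    (fun P => if P ∈ standardTableaux (p.1 + 1) k then (1 : R) else 0)
    (fun Q => x ^ mch (standardTableaux 2 k) Q)
  rw [Finset.sum_boole, Finset.filter_univ_mem] at hsum
  rw [← Finset.mul_sum, ← hsum]
  congr 1
  refine Finset.sum_congr rfl fun F _ => ?_
  rw [pow_mch]
  congr 1
  · refine if_congr ?_ rfl rfl
    rw [cols_mem_standardTableaux]
    simp_rw [zero_add, Nat.add_lt_add_iff_right]
  · refine Finset.prod_congr rfl fun i hi => if_congr ?_ rfl rfl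
    rw [hasMatchAt_cols]
    have := Finset.mem_range.1 hi
    omega

/-! ### Inverting the generating function -/

theorem coeff_genD (k n : ℕ) :
    PowerSeries.coeff n (genD (standardTableaux 2 k)) =
      Polynomial.C (1 / ((k * n).factorial : ℚ)) *
        ∑ F : Filling n k, (Polynomial.X : Polynomial ℚ) ^ mch (standardTableaux 2 k) F := by
  rw [genD, map_add, PowerSeries.coeff_mk, PowerSeries.coeff_one]
  rcases Nat.eq_zero_or_pos n with rfl | hn
  · have hcard : Fintype.card (Filling 0 k) = 1 := by
      have hF : Nonempty (Filling 0 k) :=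
        ⟨⟨Fintype.equivOfCardEq (by simp), fun j => j.elim0⟩⟩
      have : Subsingleton (Filling 0 k) :=
        ⟨fun F G => Subtype.ext (Equiv.ext fun c => c.2.elim0)⟩
      exact Fintype.card_eq_one_iff_nonempty_unique.2
        ⟨@Unique.mk' _ ⟨hF.some⟩ this⟩
    simp [mch, hcard]
  · simp [hn, hn.ne', Nat.succ_le_iff]

/-- The multiplicative inverse of `genD (standardTableaux 2 k)`. -/
noncomputable def genDInv (k : ℕ) : PowerSeries (Polynomial ℚ) :=
  PowerSeries.mk fun n => if n = 0 then 1 else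
    -((Polynomial.X - 1) ^ (n - 1) * Polynomial.C (1 / (fallingProd n k : ℚ)))

theorem choose_mul_card_standardTableaux (k i j : ℕ) :
    1 / ((k * (i + j)).factorial : ℚ) *
        ((k * (i + j)).choose (k * i) * (standardTableaux i k).card) =
      1 / (fallingProd i k : ℚ) * (1 / ((k * j).factorial : ℚ)) := by
  have h := Nat.choose_mul_factorial_mul_factorial (Nat.mul_le_mul_left k (Nat.le_add_right i j))
  rw [← Nat.mul_sub, Nat.add_sub_cancel_left] at h
  rw [card_standardTableaux, ← h]
  have h0 : ((k * (i + j)).choose (k * i) : ℚ) ≠ 0 :=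
    Nat.cast_ne_zero.2 (Nat.choose_pos (Nat.mul_le_mul_left k (Nat.le_add_right i j))).ne'
  have h1 : ((k * i).factorial : ℚ) ≠ 0 := Nat.cast_ne_zero.2 (Nat.factorial_ne_zero _)
  have h2 : ((k * j).factorial : ℚ) ≠ 0 := Nat.cast_ne_zero.2 (Nat.factorial_ne_zero _)
  have h3 : (fallingProd i k : ℚ) ≠ 0 := Nat.cast_ne_zero.2 (fallingProd_ne_zero i k)
  push_cast
  field_simp

/-- `genDInv` is the stated denominator divided by `1 - x`; its coefficients are polynomials, so the
identity holds over `ℚ[x]` and can be evaluated at `x = 0`. -/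
theorem genDInv_mul_genD (k : ℕ) : genDInv k * genD (standardTableaux 2 k) = 1 := by
  ext1 n
  rw [PowerSeries.coeff_mul, PowerSeries.coeff_one]
  cases n with
  | zero =>
    rw [Finset.Nat.antidiagonal_zero, Finset.sum_singleton, genDInv, PowerSeries.coeff_mk, genD]
    simp
  | succ n =>
    -- The split-off term is the new coefficient of `genD`; the others are the negated recurrence.
    rw [Finset.Nat.antidiagonal_succ, Finset.sum_cons, Finset.sum_map]
    simp only [genDInv, PowerSeries.coeff_mk, coeff_genD, if_true, one_mul,
      Function.Embedding.prodMap, Function.Embedding.coeFn_mk, Prod.map,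
      Function.Embedding.refl_apply, Nat.succ_eq_add_one, Nat.add_eq_zero_iff, one_ne_zero,
      and_false, if_false, Nat.add_sub_cancel, neg_mul, Finset.sum_neg_distrib]
    rw [add_neg_eq_zero, sum_pow_mch_succ, Finset.mul_sum]
    refine Finset.sum_congr rfl fun p hp => ?_
    have h := choose_mul_card_standardTableaux k (p.1 + 1) p.2
    rw [show p.1 + 1 + p.2 = n + 1 by have := mem_antidiagonal.1 hp; omega] at h
    have h' := congrArg Polynomial.C h
    rw [Polynomial.C_mul, Polynomial.C_mul, Polynomial.C_mul, Polynomial.C_eq_natCast,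
      Polynomial.C_eq_natCast] at h'
    linear_combination (Polynomial.X - 1) ^ p.1 *
      (∑ G : Filling p.2 k, (Polynomial.X : Polynomial ℚ) ^ mch (standardTableaux 2 k) G) * h'

theorem fallingProd_one (k : ℕ) : fallingProd 1 k = k.factorial := by
  simp only [fallingProd, Nat.add_sub_cancel_left, Nat.descFactorial_one]
  induction k with
  | zero => rfl
  | succ k ih => rw [Finset.prod_Icc_succ_top (by omega), ih, Nat.factorial_succ, mul_comm]

end Filling

theorem mainTheorem7 (k : ℕ) :
    (∀ n : ℕ, 1 ≤ n →
      Filling.full (Filling.standardTableaux 2 k) n = (Filling.standardTableaux n k).card ∧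
      ((Filling.standardTableaux n k).card : ℚ) =
        ((k * n).factorial : ℚ) / (Filling.fallingProd n k : ℚ)) ∧
    PowerSeries.map (algebraMap (Polynomial ℚ) (RatFunc ℚ))
        (Filling.genD (Filling.standardTableaux 2 k)) =
      PowerSeries.C (1 - RatFunc.X) *
        (PowerSeries.C (1 - RatFunc.X)
          + PowerSeries.C ((RatFunc.X - 1) / (k.factorial : RatFunc ℚ)) * PowerSeries.X
          + PowerSeries.mk fun n => if 2 ≤ n then
              (RatFunc.X - 1) ^ n / (Filling.fallingProd n k : RatFunc ℚ) else 0)⁻¹ ∧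
    Filling.genA (Filling.standardTableaux 2 k) =
      (1 - PowerSeries.C (1 / (k.factorial : ℚ)) * PowerSeries.X
        + PowerSeries.mk fun n => if 2 ≤ n then
            (-1 : ℚ) ^ n / (Filling.fallingProd n k : ℚ) else 0)⁻¹ := by
  refine ⟨fun n hn => ⟨Filling.full_standardTableaux hn k, Filling.card_standardTableaux n k⟩,
    ?_, ?_⟩
  · have hX : (1 - RatFunc.X : RatFunc ℚ) ≠ 0 := by
      rw [← RatFunc.algebraMap_X, ← map_one (algebraMap (Polynomial ℚ) (RatFunc ℚ)), ← map_sub]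
      refine RatFunc.algebraMap_ne_zero fun h => ?_
      have := congrArg (Polynomial.eval 0) h
      simp at this
    have hden : (PowerSeries.C (1 - RatFunc.X)
          + PowerSeries.C ((RatFunc.X - 1) / (k.factorial : RatFunc ℚ)) * PowerSeries.X
          + PowerSeries.mk fun n => if 2 ≤ n then
              (RatFunc.X - 1) ^ n / (Filling.fallingProd n k : RatFunc ℚ) else 0) =
        PowerSeries.C (1 - RatFunc.X) *
          PowerSeries.map (algebraMap (Polynomial ℚ) (RatFunc ℚ)) (Filling.genDInv k) := by
      ext n
      rw [PowerSeries.coeff_C_mul, PowerSeries.coeff_map, Filling.genDInv, PowerSeries.coeff_mk]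
      match n with
      | 0 => simp
      -- The linear term, written separately in the statement, fits the general pattern by
      -- `fallingProd_one`.
      | 1 =>
        simp [PowerSeries.coeff_C, Filling.fallingProd_one, RatFunc.algebraMap_C]
        ring
      | n + 2 =>
        simp [RatFunc.algebraMap_C]
        ring
    rw [PowerSeries.eq_mul_inv_iff_mul_eq, hden, mul_left_comm, ← map_mul, mul_comm (Filling.genD _),
      Filling.genDInv_mul_genD, map_one, mul_one]
    simpa using hX
  · have hden : (1 - PowerSeries.C (1 / (k.factorial : ℚ)) * PowerSeries.X
        + PowerSeries.mk fun n => if 2 ≤ n then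
            (-1 : ℚ) ^ n / (Filling.fallingProd n k : ℚ) else 0) =
        PowerSeries.map (Polynomial.evalRingHom (0 : ℚ)) (Filling.genDInv k) := by
      ext n
      rw [PowerSeries.coeff_map, Filling.genDInv, PowerSeries.coeff_mk]
      match n with
      | 0 => simp
      | 1 => simp [PowerSeries.coeff_one, Filling.fallingProd_one]
      | n + 2 =>
        simp [PowerSeries.coeff_one]
        ring
    rw [PowerSeries.eq_inv_iff_mul_eq_one, hden, Filling.genA_eq_genD_zero, ← map_mul,
      mul_comm, Filling.genDInv_mul_genD, map_one]
    simp
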